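/- Let $A$ be a self-adjoint operator on a complex Hilbert space $H$, let $N\ge 1$ be an integer, and let $D(A^j)$ be the domain of $A^j$, with $D(A^0)=H$. Let $J$ be a nonlinear map on $H$ with $J(D(A^j))\subset D(A^j)$ for $0\le j\le N$ such that, for all $\varphi,\psi\in D(A^N)$ and $0\le j\le N$, $$\|A^jJ(\varphi)\|\le C_j(\|\varphi\|,\dots,\|A^j\varphi\|)\,\|A^j\varphi\|,$$ $$\|A^j(J(\varphi)-J(\psi))\|\le C_j'(\|\varphi\|,\|\psi\|,\dots,\|A^j\varphi\|,\|A^j\psi\|)\,\|A^j(\varphi-\psi)\|,$$ where $C_j,C_j'$ are finite, monotonically increasing functions of the norms indicated. Let $\Theta$ be a complex-valued function on a complex vector space $E$ (for instance the complexification of a space of test functions), and let $\zeta,\eta\in E$ be such that $z\mapsto\Theta(\zeta+z\eta)$ is holomorphic on $\mathbb C$. For $z\in\mathbb C$ consider $$\frac{d\varphi}{dt}=-iA\varphi+J(\varphi)+\Theta(\zeta+z\eta)\varphi,\qquad \varphi(0)=\varphi_0. \tag{1}$$ A solution on $[0,T)$ is a $D(A^N)$-valued function that is differentiable in the norm of $H$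 (from the right at $t=0$) and satisfies (1) on $[0,T)$. Let $a_0,\dots,a_N,R$ be real numbers and $S=\{\varphi\in D(A^N):\|A^j\varphi\|\le a_j,\ j=0,\dots,N\}$. Then there is a $T>0$ such that the following hold. 1. For every $\varphi_0\in S$ and every $z\in\mathbb C$ with $|z|\le R$, problem (1) has a unique solution $\varphi$ on $[0,T)$, and $\varphi$ is continuous on $[0,T)$ in the graph norm $\sum_{j=0}^N\|A^j\cdot\|$. (In particular, for each $\varphi_0\in D(A^N)$ and $z\in\mathbb C$ there is such a $T>0$.) 2. For every $r>0$ there is a constant $C\ge 0$ such that for all $\varphi_0\in S$, all $z$ with $r\le|z|\le R$ and all $t\in[0,T)$, the solution satisfies $$\sum_{j=0}^N\|A^j\varphi(t)\|\le\Big(\sum_{j=0}^N\|A^j\varphi_0\|\Big)e^{tC|z|}.$$ 3. There is a constant $C\ge0$ such that for all $\varphi_0\in S$, all $z$ with $|z|\le R$ and all $t\in[0,T)$, the solution satisfies $$\sum_{j=0}^N\|A^j\varphi(t)\|\le\Big(\sum_{j=0}^N\|A^j\varphi_0\|\Big)e^{tC(1+|z|)}.$$ -/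

import Mathlib

open Set

namespace SemilinearEvolution

noncomputable section

variable {H : Type*} [NormedAddCommGroup H] [InnerProductSpace ℂ H]

open Classical in
/-- The action `x ↦ A x` of a partially defined operator, extended by the junk value `0` outside
`D(A)`. It is only ever used at points of `D(A)`. -/
def act (A : H →ₗ.[ℂ] H) (x : H) : H :=
  if h : x ∈ A.domain then A ⟨x, h⟩ else 0

/-- `A ^ j x = A (A (... (A x)))`, meaningful for `x ∈ D(A ^ j)`. -/
def powAct (A : H →ₗ.[ℂ] H) (j : ℕ) (x : H) : H :=
  (act A)^[j] x

/-- The domain `D(A ^ j)`: all `x` such that `x, A x, ..., A ^ (j - 1) x` lie in `D(A)`.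
In particular `D(A ^ 0) = H`. -/
def powDom (A : H →ₗ.[ℂ] H) (j : ℕ) : Set H :=
  {x | ∀ i < j, powAct A i x ∈ A.domain}

/-- The list of norms `(‖x‖, ‖A x‖, ..., ‖A ^ j x‖)`. -/
def norms (A : H →ₗ.[ℂ] H) (j : ℕ) (x : H) : Fin (j + 1) → ℝ :=
  fun i => ‖powAct A i x‖

/-- The graph norm `∑ j ≤ N, ‖A ^ j x‖` of `D(A ^ N)`. -/
def graphNorm (A : H →ₗ.[ℂ] H) (N : ℕ) (x : H) : ℝ :=
  ∑ j ∈ Finset.range (N + 1), ‖powAct A j x‖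

/-- The growth and local Lipschitz conditions on the nonlinearity. `J` is a total function; values
outside the domain of definition of the nonlinearity are unconstrained apart from `mapsTo`, and both
estimates concern points of `D(A ^ N)` only. The constants are (weakly) increasing functions of the
norms indicated. -/
structure Nonlinearity (A : H →ₗ.[ℂ] H) (N : ℕ) (J : H → H) : Prop where
  mapsTo : ∀ j ≤ N, MapsTo J (powDom A j) (powDom A j)
  growth : ∀ j ≤ N, ∃ C : (Fin (j + 1) → ℝ) → ℝ, Monotone C ∧
    ∀ φ ∈ powDom A N, ‖powAct A j (J φ)‖ ≤ C (norms A j φ) * ‖powAct A j φ‖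
  lipschitz : ∀ j ≤ N, ∃ C : (Fin (j + 1) → ℝ) × (Fin (j + 1) → ℝ) → ℝ, Monotone C ∧
    ∀ φ ∈ powDom A N, ∀ ψ ∈ powDom A N,
      ‖powAct A j (J φ - J ψ)‖ ≤ C (norms A j φ, norms A j ψ) * ‖powAct A j (φ - ψ)‖

/-- `φ` is a `D(A ^ N)`-valued strong solution on `[0, T)` of
`dφ/dt = - i A φ + J φ + θ φ`, `φ 0 = φ₀`. The derivative is taken in the norm of `H`, one-sided
at `t = 0`; values of `φ` outside `[0, T)` are irrelevant. -/
structure IsStrongSolution (A : H →ₗ.[ℂ] H) (N : ℕ) (J : H → H) (θ : ℂ) (φ₀ : H) (T : ℝ)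
    (φ : ℝ → H) : Prop where
  mem : ∀ t ∈ Ico 0 T, φ t ∈ powDom A N
  initial : φ 0 = φ₀
  deriv : ∀ t ∈ Ico 0 T,
    HasDerivWithinAt φ (-(Complex.I • act A (φ t)) + J (φ t) + θ • φ t) (Ico 0 T) t

/-- Continuity on `[0, T)` with respect to the graph norm of `D(A ^ N)`. -/
def GraphContinuousOn (A : H →ₗ.[ℂ] H) (N : ℕ) (T : ℝ) (φ : ℝ → H) : Prop :=
  ∀ j ≤ N, ContinuousOn (fun t => powAct A j (φ t)) (Ico 0 T)

end

end SemilinearEvolution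

/-! Let V(t) = exp(-itA). In the interaction picture w(t) = V(-t)φ(t) the unbounded term disappears,
leaving w' = V(-t)(J + θ)(V(t)w). On D(A^N) this field is bounded and Lipschitz on balls, so
Picard–Lindelöf applies. The space D(A^N) is realized as the tuples (x, Ax, ..., A^N x), a closed
subspace of H^(N+1) because A is closed. The group acts on each entry isometrically.

The constants depend only on a radius M bounding the data and on a bound κ for |Θ(ζ + zη)| over |z|
≤ R, so one T serves all data. The growth bound holds entry by entry, hence Gronwall gives ‖A^j
φ(t)‖ ≤ ‖A^j φ₀‖ e^(Kt) with the same K for every j (`exists_solution`). Both exponential estimates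
follow from K ≤ (K/r)|z| for |z| ≥ r and K ≤ K(1 + |z|).

Uniqueness is Gronwall for V(-t)(φ - ψ) in H (`IsStrongSolution.eqOn`). The group itself is
constructed as the strong limit of exp(-itB_n) with bounded self-adjoint B_n approximating A
(`exists_isEvolutionGroup`). -/

namespace SemilinearEvolution

open Filter Topology InnerProductSpace
open scoped NNReal

variable {H : Type*} [NormedAddCommGroup H] [InnerProductSpace ℂ H]

/-! ### Algebra of the totalized action of A -/

section Act

variable {A : H →ₗ.[ℂ] H}

theorem act_of_mem {x : H} (hx : x ∈ A.domain) : act A x = A ⟨x, hx⟩ := dif_pos hx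

theorem act_add {x y : H} (hx : x ∈ A.domain) (hy : y ∈ A.domain) :
    act A (x + y) = act A x + act A y := by
  rw [act_of_mem hx, act_of_mem hy, act_of_mem (A.domain.add_mem hx hy), ← A.map_add]
  rfl

theorem act_smul (c : ℂ) {x : H} (hx : x ∈ A.domain) : act A (c • x) = c • act A x := by
  rw [act_of_mem hx, act_of_mem (A.domain.smul_mem c hx), ← A.map_smul]
  rfl

theorem act_zero : act A 0 = 0 := by
  simpa using act_smul (A := A) 0 A.domain.zero_mem

theorem act_sub {x y : H} (hx : x ∈ A.domain) (hy : y ∈ A.domain) :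
    act A (x - y) = act A x - act A y := by
  rw [sub_eq_add_neg, ← neg_one_smul ℂ y, act_add hx (A.domain.smul_mem _ hy), act_smul _ hy]
  module

theorem mem_graph_iff_act {p : H × H} : p ∈ A.graph ↔ p.1 ∈ A.domain ∧ act A p.1 = p.2 := by
  rw [LinearPMap.mem_graph_iff]
  constructor
  · rintro ⟨y, h1, h2⟩
    have h : p.1 ∈ A.domain := h1 ▸ y.2
    refine ⟨h, ?_⟩
    rw [act_of_mem h, ← h2]
    congr 1
    exact Subtype.ext h1.symm
  · rintro ⟨h, h2⟩
    exact ⟨⟨p.1, h⟩, rfl, by rw [← h2, act_of_mem h]⟩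

end Act

/-! ### Resolvents of a self-adjoint operator off the real axis -/

section Resolvent

variable [CompleteSpace H] {A : H →ₗ.[ℂ] H}

theorem inner_act_left (hA : IsSelfAdjoint A) {x y : H} (hx : x ∈ A.domain) (hy : y ∈ A.domain) :
    ⟪act A x, y⟫_ℂ = ⟪x, act A y⟫_ℂ := by
  have h := LinearPMap.adjoint_isFormalAdjoint hA.dense_domain
  rw [LinearPMap.isSelfAdjoint_def.1 hA] at h
  rw [act_of_mem hx, act_of_mem hy]
  exact h ⟨x, hx⟩ ⟨y, hy⟩

theorem inner_act_self_im (hA : IsSelfAdjoint A) {x : H} (hx : x ∈ A.domain) :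
    (⟪act A x, x⟫_ℂ).im = 0 := by
  have h := inner_conj_symm (𝕜 := ℂ) x (act A x)
  rw [← inner_act_left hA hx hx] at h
  exact Complex.conj_eq_iff_im.1 h

/-- The cross term vanishes because ⟪Ax, x⟫ is real. All resolvent bounds come from this identity.
-/
theorem norm_act_add_sq (hA : IsSelfAdjoint A) (l : ℝ) {x : H} (hx : x ∈ A.domain) :
    ‖act A x + (Complex.I * l) • x‖ ^ 2 = ‖act A x‖ ^ 2 + l ^ 2 * ‖x‖ ^ 2 := by
  rw [norm_add_sq (𝕜 := ℂ), inner_smul_right, norm_smul, mul_pow]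
  simp [inner_act_self_im hA hx]

theorem mem_domain_of_orthogonal (hA : IsSelfAdjoint A) (l : ℝ) {y : H}
    (h : ∀ x ∈ A.domain, ⟪act A x + (Complex.I * l) • x, y⟫_ℂ = 0) : y ∈ A.domain := by
  have : y ∈ A.adjoint.domain := by
    -- Orthogonality to the range of A + il says exactly that A*y = il y.
    refine LinearPMap.mem_adjoint_domain_of_exists y ⟨(Complex.I * l) • y, fun x => ?_⟩
    have hx := congrArg (starRingEnd ℂ) (h x x.2)
    rw [inner_conj_symm, inner_add_right, inner_smul_right, act_of_mem x.2] at hx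
    rw [inner_smul_left]
    simp at hx ⊢
    linear_combination -hx
  rwa [LinearPMap.isSelfAdjoint_def.1 hA] at this

theorem eq_zero_of_orthogonal (hA : IsSelfAdjoint A) {l : ℝ} (hl : l ≠ 0) {y : H}
    (h : ∀ x ∈ A.domain, ⟪act A x + (Complex.I * l) • x, y⟫_ℂ = 0) : y = 0 := by
  have hy := mem_domain_of_orthogonal hA l h
  have h1 := congrArg Complex.im (h y hy)
  rw [inner_add_left, inner_smul_left, Complex.add_im, inner_act_self_im hA hy,
    inner_self_eq_norm_sq_to_K] at h1
  have h2 : l * ‖y‖ ^ 2 = 0 := by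
    have : ((‖y‖ : ℂ) ^ 2) = ((‖y‖ ^ 2 : ℝ) : ℂ) := by push_cast; rfl
    simp [this, -Complex.ofReal_pow] at h1
    simpa using h1
  simpa [hl] using h2

/-- `R` is a bounded two-sided inverse of `A + i l`. -/
structure IsResolvent (A : H →ₗ.[ℂ] H) (l : ℝ) (R : H →L[ℂ] H) : Prop where
  mem : ∀ y, R y ∈ A.domain
  act_apply : ∀ y, act A (R y) = y - (Complex.I * l) • R y
  apply_act : ∀ x ∈ A.domain, R (act A x) = x - (Complex.I * l) • R x

/-- Viewed on the complete graph of A, the map A + il is bounded below, so it is injective with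
closed range. The range is dense, since a vector y orthogonal to it lies in D(A) and the imaginary
part of ⟪(A + il)y, y⟫ = 0 forces l‖y‖² = 0. -/
theorem exists_isResolvent (hA : IsSelfAdjoint A) {l : ℝ} (hl : l ≠ 0) :
    ∃ R, IsResolvent A l R := by
  have hcl : IsClosed (A.graph : Set (H × H)) := hA.isClosed
  have : CompleteSpace A.graph := hcl.completeSpace_coe
  let L : A.graph →L[ℂ] H :=
    (ContinuousLinearMap.snd ℂ H H + (Complex.I * l : ℂ) • ContinuousLinearMap.fst ℂ H H).comp
      A.graph.subtypeL
  have hLapp : ∀ p : A.graph, L p = p.1.2 + (Complex.I * l) • p.1.1 := fun p => rfl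
  have hLnorm : ∀ p : A.graph, ‖L p‖ ^ 2 = ‖p.1.2‖ ^ 2 + l ^ 2 * ‖p.1.1‖ ^ 2 := by
    intro p
    obtain ⟨h1, h2⟩ := mem_graph_iff_act.1 p.2
    rw [hLapp, ← h2, norm_act_add_sq hA l h1]
  have hl' : 0 < |l| := abs_pos.2 hl
  have hanti : AntilipschitzWith (1 + ‖l‖₊⁻¹) L := by
    refine ContinuousLinearMap.antilipschitz_of_bound L fun p => ?_
    have e2 : ‖p.1.2‖ ≤ ‖L p‖ := by
      refine (abs_le_of_sq_le_sq' ?_ (norm_nonneg _)).2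
      rw [hLnorm]
      exact le_add_of_nonneg_right (by positivity)
    have e1 : |l| * ‖p.1.1‖ ≤ ‖L p‖ := by
      refine (abs_le_of_sq_le_sq' ?_ (norm_nonneg _)).2
      rw [hLnorm, mul_pow, sq_abs]
      exact le_add_of_nonneg_left (by positivity)
    have e1' : ‖p.1.1‖ ≤ |l|⁻¹ * ‖L p‖ := by
      rwa [inv_mul_eq_div, le_div_iff₀' hl']
    have e3 : ‖p‖ ≤ max ‖p.1.1‖ ‖p.1.2‖ := le_rfl
    have h0 : 0 ≤ |l|⁻¹ * ‖L p‖ := by positivity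
    refine e3.trans (max_le ?_ ?_)
    · push_cast
      rw [Real.norm_eq_abs]
      linarith [norm_nonneg (L p)]
    · push_cast
      rw [Real.norm_eq_abs]
      linarith
  have hrange : L.range = ⊤ := by
    have hcr : IsClosed (L.range : Set H) := by
      rw [LinearMap.coe_range]
      exact hanti.isClosed_range L.uniformContinuous
    rw [← hcr.submodule_topologicalClosure_eq, Submodule.topologicalClosure_eq_top_iff,
      Submodule.eq_bot_iff]
    intro y hy
    refine eq_zero_of_orthogonal hA hl fun x hx => ?_
    exact (Submodule.mem_orthogonal _ y).1 hy _
      ⟨⟨(x, act A x), mem_graph_iff_act.2 ⟨hx, rfl⟩⟩, rfl⟩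
  let e := ContinuousLinearEquiv.ofBijective L
    (LinearMap.ker_eq_bot.2 hanti.injective) hrange
  have he : ∀ y, L (e.symm y) = y := fun y => e.apply_symm_apply y
  refine ⟨(ContinuousLinearMap.fst ℂ H H).comp
    (A.graph.subtypeL.comp (e.symm : H →L[ℂ] A.graph)), ?_, ?_, ?_⟩
  · exact fun y => (mem_graph_iff_act.1 (e.symm y).2).1
  · intro y
    have h := (mem_graph_iff_act.1 (e.symm y).2).2
    have h2 := he y
    rw [hLapp, ← h] at h2
    exact eq_sub_of_add_eq h2
  · intro x hx
    let p : A.graph := ⟨(x, act A x), mem_graph_iff_act.2 ⟨hx, rfl⟩⟩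
    have hp : e.symm (L p) = p := e.symm_apply_apply p
    rw [eq_sub_iff_add_eq, ← map_smul, ← map_add]
    exact congrArg (fun q : A.graph => q.1.1) hp

namespace IsResolvent

variable {l m : ℝ} {R S : H →L[ℂ] H}

theorem norm_smul_apply_le (hA : IsSelfAdjoint A) (hR : IsResolvent A l R) (y : H) :
    ‖(Complex.I * l) • R y‖ ≤ ‖y‖ := by
  have h := norm_act_add_sq hA l (hR.mem y)
  rw [hR.act_apply, sub_add_cancel] at h
  refine (abs_le_of_sq_le_sq' ?_ (norm_nonneg _)).2
  rw [h, norm_smul, mul_pow]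
  simp

theorem norm_apply_le (hA : IsSelfAdjoint A) (hR : IsResolvent A l R) (hl : 0 < |l|) (y : H) :
    ‖R y‖ ≤ |l|⁻¹ * ‖y‖ := by
  have h := hR.norm_smul_apply_le hA y
  rw [norm_smul] at h
  rw [inv_mul_eq_div, le_div_iff₀' hl]
  simpa using h

theorem inner_left (hA : IsSelfAdjoint A) (hR : IsResolvent A l R) (hS : IsResolvent A (-l) S)
    (x y : H) : ⟪R x, y⟫_ℂ = ⟪x, S y⟫_ℂ := by
  have hx : x = act A (R x) + (Complex.I * l) • R x := by rw [hR.act_apply]; abel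
  have hy : y = act A (S y) - (Complex.I * l) • S y := by
    rw [hS.act_apply]; push_cast; module
  have h := inner_act_left hA (hR.mem x) (hS.mem y)
  conv_lhs => rw [hy]
  conv_rhs => rw [hx]
  rw [inner_sub_right, inner_add_left, inner_smul_left, inner_smul_right, h]
  simp
  ring

end IsResolvent

end Resolvent

/-! ### Commuting with A versus commuting with a resolvent -/

section Commutes

variable {A : H →ₗ.[ℂ] H}

/-- `B` maps `D(A)` to itself and commutes with `A` there. -/
def CommutesWith (A : H →ₗ.[ℂ] H) (B : H →L[ℂ] H) : Prop :=
  ∀ x ∈ A.domain, B x ∈ A.domain ∧ act A (B x) = B (act A x)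

theorem IsResolvent.commutesWith {l : ℝ} {R : H →L[ℂ] H} (hR : IsResolvent A l R) :
    CommutesWith A R := fun x hx => ⟨hR.mem x, by rw [hR.act_apply, hR.apply_act x hx]⟩

theorem CommutesWith.comm_resolvent {l : ℝ} {R B : H →L[ℂ] H} (hB : CommutesWith A B)
    (hR : IsResolvent A l R) (y : H) : B (R y) = R (B y) := by
  obtain ⟨h1, h2⟩ := hB (R y) (hR.mem y)
  have h3 := hR.apply_act _ h1
  rw [h2, hR.act_apply] at h3
  simp only [map_sub, map_smul] at h3
  exact (sub_left_injective h3).symm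

/-- D(A) is the range of R. An identity between bounded operators survives strong limits, which is
how commutation with A reaches the limit group. -/
theorem commutesWith_of_comm_resolvent {l : ℝ} {R B : H →L[ℂ] H} (hR : IsResolvent A l R)
    (h : ∀ y, B (R y) = R (B y)) : CommutesWith A B := by
  intro x hx
  have hx' : x = R (act A x + (Complex.I * l) • x) := by
    rw [map_add, hR.apply_act x hx, map_smul]; abel
  set y := act A x + (Complex.I * l) • x with hy
  have hBx : B x = R (B y) := by rw [hx', h]
  refine ⟨hBx ▸ hR.mem _, ?_⟩
  rw [hBx, hR.act_apply, ← hBx, hy, map_add, map_smul]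
  abel

end Commutes

/-! ### Strong convergence of contractions from a dense set -/

section Dense

theorem tendsto_of_dense_of_norm_le {ι : Type*} {l : Filter ι} {F : ι → H →L[ℂ] H} {f : H →L[ℂ] H}
    (hF : ∀ i x, ‖F i x‖ ≤ ‖x‖) {D : Set H} (hD : Dense D)
    (h : ∀ x ∈ D, Tendsto (fun i => F i x) l (𝓝 (f x))) (x : H) :
    Tendsto (fun i => F i x) l (𝓝 (f x)) := by
  have hlip : ∀ i, LipschitzWith 1 (F i) := fun i =>
    LipschitzWith.of_dist_le_mul fun x y => by
      simpa [dist_eq_norm] using hF i (x - y)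
  have hcl := (LipschitzWith.uniformEquicontinuous (fun i => ⇑(F i)) 1
    hlip).equicontinuous.isClosed_setOfPred_tendsto (l := l) (f := f) f.continuous
  have hsub : D ⊆ {x | Tendsto (fun i => F i x) l (𝓝 (f x))} := h
  exact (hcl.closure_subset_iff.2 hsub) (hD x)

theorem cauchySeq_of_dense_of_norm_le {F : ℕ → H →L[ℂ] H}
    (hF : ∀ i x, ‖F i x‖ ≤ ‖x‖) {D : Set H} (hD : Dense D)
    (h : ∀ x ∈ D, CauchySeq (fun i => F i x)) (x : H) :
    CauchySeq (fun i => F i x) := by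
  rw [Metric.cauchySeq_iff]
  intro ε hε
  obtain ⟨y, hy, hxy⟩ := Metric.dense_iff.1 hD x (ε / 4) (by positivity)
  rw [Metric.mem_ball, dist_comm, dist_eq_norm] at hy
  obtain ⟨M, hM⟩ := Metric.cauchySeq_iff.1 (h y hxy) (ε / 4) (by positivity)
  refine ⟨M, fun m hm n hn => ?_⟩
  have h1 := hM m hm n hn
  rw [dist_eq_norm] at h1 ⊢
  have e : F m x - F n x = F m (x - y) + (F m y - F n y) - F n (x - y) := by
    simp only [map_sub]; abel
  rw [e]
  have := norm_sub_le (F m (x - y) + (F m y - F n y)) (F n (x - y))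
  have := norm_add_le (F m (x - y)) (F m y - F n y)
  linarith [hF m (x - y), hF n (x - y)]

end Dense

/-! ### Unitary groups with bounded generator -/

section ExpGroup

variable [CompleteSpace H]

/-- The group `t ↦ exp (- i t B)` of a bounded operator `B`. -/
noncomputable def expGroup (B : H →L[ℂ] H) (t : ℝ) : H →L[ℂ] H :=
  NormedSpace.exp ((t : ℂ) • (-Complex.I • B))

variable {B C : H →L[ℂ] H}

theorem expGroup_zero : expGroup B 0 = 1 := by simp [expGroup]

theorem hasDerivAt_expGroup (t : ℝ) (x : H) :
    HasDerivAt (fun s => expGroup B s x) (expGroup B t (-Complex.I • B x)) t := by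
  have h := (hasDerivAt_exp_smul_const (𝕂 := ℂ) (-Complex.I • B) (t : ℂ)).scomp t
    Complex.ofRealCLM.hasDerivAt
  have h' := ((ContinuousLinearMap.apply ℂ H x).restrictScalars ℝ).hasFDerivAt.comp_hasDerivAt t h
  rw [show Complex.ofRealCLM 1 = 1 from Complex.ofReal_one, one_smul] at h'
  exact h'

theorem continuous_expGroup (x : H) : Continuous fun s => expGroup B s x :=
  continuous_iff_continuousAt.2 fun t => (hasDerivAt_expGroup t x).continuousAt

theorem expGroup_add (s t : ℝ) : expGroup B (s + t) = expGroup B s * expGroup B t := by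
  let : NormedAlgebra ℚ (H →L[ℂ] H) := NormedAlgebra.restrictScalars ℚ ℂ _
  unfold expGroup
  rw [← NormedSpace.exp_add_of_commute]
  · congr 1
    push_cast
    module
  · exact ((Commute.refl _).smul_left _).smul_right _

theorem expGroup_comm (h : Commute B C) (t : ℝ) : Commute (expGroup B t) C :=
  Commute.exp_left ((h.smul_left _).smul_left _)

theorem expGroup_norm (hB : IsSelfAdjoint B) (t : ℝ) (x : H) : ‖expGroup B t x‖ = ‖x‖ := by
  have hs : IsSelfAdjoint ((-t : ℂ) • B) := by
    rw [IsSelfAdjoint, star_smul, hB.star_eq]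
    simp
  have hu : expGroup B t ∈ unitary (H →L[ℂ] H) := by
    have h := (selfAdjoint.expUnitary ⟨_, hs⟩).2
    rw [selfAdjoint.expUnitary_coe] at h
    have e : Complex.I • (-t : ℂ) • B = (t : ℂ) • (-Complex.I • B) := by module
    rw [e] at h
    exact h
  exact ContinuousLinearMap.norm_map_of_mem_unitary hu x

/-- Commutativity factors exp(-itB) as exp(-itC) exp(-it(B - C)). The first factor is isometric, and
the mean value inequality bounds the displacement by the second. -/
theorem expGroup_sub_apply_norm_le (hB : IsSelfAdjoint B) (hC : IsSelfAdjoint C)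
    (h : Commute B C) (t : ℝ) (x : H) :
    ‖expGroup B t x - expGroup C t x‖ ≤ |t| * ‖B x - C x‖ := by
  let : NormedAlgebra ℚ (H →L[ℂ] H) := NormedAlgebra.restrictScalars ℚ ℂ _
  have e : expGroup B t = expGroup C t * expGroup (B - C) t := by
    unfold expGroup
    rw [← NormedSpace.exp_add_of_commute]
    · congr 1
      module
    · have : Commute C (B - C) := h.symm.sub_right (Commute.refl C)
      exact (((this.smul_left _).smul_right _).smul_left _).smul_right _
  have e2 : expGroup B t x - expGroup C t x = expGroup C t (expGroup (B - C) t x - x) := by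
    rw [e, map_sub]; rfl
  rw [e2, expGroup_norm hC]
  have := Convex.norm_image_sub_le_of_norm_hasDerivWithin_le (s := univ) (x := 0) (y := t)
    (C := ‖B x - C x‖) (fun s _ => (hasDerivAt_expGroup (B := B - C) s x).hasDerivWithinAt)
    (fun s _ => by rw [expGroup_norm (hB.sub hC)]; simp [norm_smul])
    convex_univ (mem_univ _) (mem_univ _)
  rw [expGroup_zero] at this
  simpa [mul_comm] using this

end ExpGroup

/-! ### Bounded self-adjoint approximations of A -/

section Yosida

variable [CompleteSpace H] {A : H →ₗ.[ℂ] H}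

open Classical in
/-- The inverse of `A + i l`, or `0` if there is none. -/
noncomputable def resolventOp (A : H →ₗ.[ℂ] H) (l : ℝ) : H →L[ℂ] H :=
  if h : ∃ R, IsResolvent A l R then h.choose else 0

theorem isResolvent_resolventOp (hA : IsSelfAdjoint A) {l : ℝ} (hl : l ≠ 0) :
    IsResolvent A l (resolventOp A l) := by
  have h := exists_isResolvent hA hl
  rw [resolventOp, dif_pos h]
  exact h.choose_spec

/-- The bounded approximation `l² A (A² + l²)⁻¹` of `A`. -/
noncomputable def yosida (A : H →ₗ.[ℂ] H) (l : ℝ) : H →L[ℂ] H :=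
  ((l : ℂ) ^ 2 / 2) • (resolventOp A l + resolventOp A (-l))

theorem isSelfAdjoint_yosida (hA : IsSelfAdjoint A) {l : ℝ} (hl : l ≠ 0) :
    IsSelfAdjoint (yosida A l) := by
  rw [ContinuousLinearMap.isSelfAdjoint_iff_isSymmetric]
  intro x y
  have h1 := isResolvent_resolventOp hA hl
  have h2 := isResolvent_resolventOp hA (neg_ne_zero.2 hl)
  have e1 := h1.inner_left hA h2 x y
  have e2 := h2.inner_left hA ((neg_neg l).symm ▸ h1) x y
  rw [neg_neg] at e2
  have e3 : (starRingEnd ℂ) ((l : ℂ) ^ 2 / 2) = (l : ℂ) ^ 2 / 2 := by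
    rw [map_div₀, map_pow, Complex.conj_ofReal, Complex.conj_ofNat]
  simp only [ContinuousLinearMap.coe_coe, yosida, smul_apply,
    add_apply, inner_smul_left, inner_smul_right, inner_add_left,
    inner_add_right, e1, e2, e3]
  ring

theorem commute_resolventOp_yosida (hA : IsSelfAdjoint A) {l m : ℝ} (hl : l ≠ 0) (hm : m ≠ 0) :
    Commute (yosida A l) (resolventOp A m) := by
  have key : ∀ k : ℝ, k ≠ 0 → Commute (resolventOp A k) (resolventOp A m) := fun k hk =>
    ContinuousLinearMap.ext fun y =>
      (isResolvent_resolventOp hA hk).commutesWith.comm_resolvent (isResolvent_resolventOp hA hm) y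
  exact ((key l hl).add_left (key (-l) (neg_ne_zero.2 hl))).smul_left _

theorem commute_yosida (hA : IsSelfAdjoint A) {l m : ℝ} (hl : l ≠ 0) (hm : m ≠ 0) :
    Commute (yosida A l) (yosida A m) :=
  ((commute_resolventOp_yosida hA hl hm).add_right
    (commute_resolventOp_yosida hA hl (neg_ne_zero.2 hm))).smul_right _

/-- Exhibits the approximation as the mean of two contractions applied to Ax, each tending strongly
to the identity as |l| → ∞; both the uniform bound and the convergence follow. -/
theorem yosida_apply (hA : IsSelfAdjoint A) {l : ℝ} (hl : l ≠ 0) {x : H} (hx : x ∈ A.domain) :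
    yosida A l x = (1 / 2 : ℂ) • ((Complex.I * l) • resolventOp A l (act A x) +
      (Complex.I * (-l : ℝ)) • resolventOp A (-l) (act A x)) := by
  rw [(isResolvent_resolventOp hA hl).apply_act x hx,
    (isResolvent_resolventOp hA (neg_ne_zero.2 hl)).apply_act x hx]
  simp only [yosida, smul_apply, add_apply, smul_add,
    smul_sub, smul_smul]
  match_scalars
  · linear_combination ((l : ℂ) ^ 2 / 2) * Complex.I_sq
  · linear_combination ((l : ℂ) ^ 2 / 2) * Complex.I_sq
  · ring

theorem norm_yosida_apply_le (hA : IsSelfAdjoint A) {l : ℝ} (hl : l ≠ 0) {x : H}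
    (hx : x ∈ A.domain) : ‖yosida A l x‖ ≤ ‖act A x‖ := by
  rw [yosida_apply hA hl hx, norm_smul]
  have h1 := (isResolvent_resolventOp hA hl).norm_smul_apply_le hA (act A x)
  have h2 := (isResolvent_resolventOp hA (neg_ne_zero.2 hl)).norm_smul_apply_le hA (act A x)
  have h3 := norm_add_le ((Complex.I * l) • resolventOp A l (act A x))
    ((Complex.I * (-l : ℝ)) • resolventOp A (-l) (act A x))
  have : ‖(1 / 2 : ℂ)‖ = 1 / 2 := by simp
  rw [this]
  linarith

theorem tendsto_smul_resolventOp (hA : IsSelfAdjoint A) {u : ℕ → ℝ} (hu : ∀ n, u n ≠ 0)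
    (hu' : Tendsto (fun n => |u n|) atTop atTop) (y : H) :
    Tendsto (fun n => (Complex.I * u n) • resolventOp A (u n) y) atTop (𝓝 y) := by
  refine tendsto_of_dense_of_norm_le (F := fun n => (Complex.I * u n) • resolventOp A (u n))
    (f := ContinuousLinearMap.id ℂ H)
    (fun n x => (isResolvent_resolventOp hA (hu n)).norm_smul_apply_le hA x) hA.dense_domain
    (fun x hx => ?_) y
  rw [tendsto_iff_norm_sub_tendsto_zero]
  have hlim : Tendsto (fun n => |u n|⁻¹ * ‖act A x‖) atTop (𝓝 0) := by
    simpa using (tendsto_inv_atTop_zero.comp hu').mul_const ‖act A x‖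
  refine squeeze_zero (fun _ => norm_nonneg _) (fun n => ?_) hlim
  have hR := isResolvent_resolventOp hA (hu n)
  have e : ((Complex.I * u n) • resolventOp A (u n)) x - ContinuousLinearMap.id ℂ H x
      = - resolventOp A (u n) (act A x) := by
    rw [hR.apply_act x hx]
    simp
  rw [e, norm_neg]
  exact hR.norm_apply_le hA (abs_pos.2 (hu n)) _

theorem tendsto_yosida (hA : IsSelfAdjoint A) {x : H} (hx : x ∈ A.domain) :
    Tendsto (fun n : ℕ => yosida A (n + 1 : ℕ) x) atTop (𝓝 (act A x)) := by
  have hne : ∀ n : ℕ, ((n + 1 : ℕ) : ℝ) ≠ 0 := fun n => Nat.cast_ne_zero.2 n.succ_ne_zero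
  have hlim : Tendsto (fun n : ℕ => |((n + 1 : ℕ) : ℝ)|) atTop atTop := by
    simp only [Nat.abs_cast]
    exact tendsto_natCast_atTop_atTop.comp (tendsto_add_atTop_nat 1)
  have h1 := tendsto_smul_resolventOp hA hne hlim (act A x)
  have h2 := tendsto_smul_resolventOp hA (fun n => neg_ne_zero.2 (hne n))
    (by simpa only [abs_neg] using hlim) (act A x)
  have h := (h1.add h2).const_smul (1 / 2 : ℂ)
  have e : (1 / 2 : ℂ) • (act A x + act A x) = act A x := by module
  rw [e] at h
  exact h.congr fun n => (yosida_apply hA (hne n) hx).symm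

end Yosida

/-! ### The unitary group generated by -iA -/

section Group

variable [CompleteSpace H] {A : H →ₗ.[ℂ] H}

/-- `V` is the strongly continuous unitary group `t ↦ exp (- i t A)`. -/
structure IsEvolutionGroup (A : H →ₗ.[ℂ] H) (V : ℝ → H →L[ℂ] H) : Prop where
  map_zero : ∀ x, V 0 x = x
  map_add : ∀ s t x, V (s + t) x = V s (V t x)
  norm_map : ∀ t x, ‖V t x‖ = ‖x‖
  continuous : ∀ x, Continuous fun t => V t x
  commutesWith : ∀ t, CommutesWith A (V t)
  hasDerivAt : ∀ x ∈ A.domain, ∀ t,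
    HasDerivAt (fun s => V s x) (V t (-Complex.I • act A x)) t

theorem exists_isEvolutionGroup (hA : IsSelfAdjoint A) : ∃ V, IsEvolutionGroup A V := by
  have hne : ∀ n : ℕ, ((n + 1 : ℕ) : ℝ) ≠ 0 := fun n => Nat.cast_ne_zero.2 n.succ_ne_zero
  let B : ℕ → H →L[ℂ] H := fun n => yosida A (n + 1 : ℕ)
  have hB : ∀ n, IsSelfAdjoint (B n) := fun n => isSelfAdjoint_yosida hA (hne n)
  have hBt : ∀ x ∈ A.domain, Tendsto (fun n => B n x) atTop (𝓝 (act A x)) :=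
    fun x hx => tendsto_yosida hA hx
  have hnorm : ∀ t n x, ‖expGroup (B n) t x‖ = ‖x‖ := fun t n x => expGroup_norm (hB n) t x
  have hcauchy : ∀ t x, CauchySeq fun n => expGroup (B n) t x := fun t =>
    cauchySeq_of_dense_of_norm_le (fun n x => (hnorm t n x).le) hA.dense_domain fun x hx => by
      have hc := Metric.cauchySeq_iff.1 (hBt x hx).cauchySeq
      rw [Metric.cauchySeq_iff]
      intro ε hε
      obtain ⟨M, hM⟩ := hc (ε / (|t| + 1)) (by positivity)
      refine ⟨M, fun m hm n hn => ?_⟩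
      have h1 := hM m hm n hn
      rw [dist_eq_norm] at h1 ⊢
      refine (expGroup_sub_apply_norm_le (hB m) (hB n)
        (commute_yosida hA (hne m) (hne n)) t x).trans_lt ?_
      rw [lt_div_iff₀ (by positivity)] at h1
      nlinarith [norm_nonneg (B m x - B n x)]
  choose f hf using fun t x => cauchySeq_tendsto_of_complete (hcauchy t x)
  let V : ℝ → H →L[ℂ] H := fun t =>
    continuousLinearMapOfTendsto (fun n => expGroup (B n) t) (tendsto_pi_nhds.2 (hf t))
  have hV : ∀ t x, Tendsto (fun n => expGroup (B n) t x) atTop (𝓝 (V t x)) := hf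
  have hVnorm : ∀ t x, ‖V t x‖ = ‖x‖ := fun t x =>
    tendsto_nhds_unique (hV t x).norm (by simp only [hnorm]; exact tendsto_const_nhds)
  have hV0 : ∀ x, V 0 x = x := fun x =>
    tendsto_nhds_unique (hV 0 x) (by
      simp only [expGroup_zero]; exact tendsto_const_nhds)
  have hcomp : ∀ t (u : ℕ → H) (y : H), Tendsto u atTop (𝓝 y) →
      Tendsto (fun n => expGroup (B n) t (u n)) atTop (𝓝 (V t y)) := by
    intro t u y hu
    have h1 : Tendsto (fun n => expGroup (B n) t (u n - y)) atTop (𝓝 0) := by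
      rw [tendsto_zero_iff_norm_tendsto_zero]
      simp only [hnorm]
      exact tendsto_iff_norm_sub_tendsto_zero.1 hu
    simpa using h1.add (hV t y)
  have hVadd : ∀ s t x, V (s + t) x = V s (V t x) := fun s t x =>
    tendsto_nhds_unique (hV (s + t) x) (by
      simp only [expGroup_add]
      exact hcomp s _ _ (hV t x))
  have hVcomm : ∀ t, CommutesWith A (V t) := fun t => by
    refine commutesWith_of_comm_resolvent (isResolvent_resolventOp hA one_ne_zero) fun y => ?_
    refine tendsto_nhds_unique (hV t _)
      ((((resolventOp A 1).continuous.tendsto _).comp (hV t y)).congr fun n => ?_)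
    exact (DFunLike.congr_fun
      (expGroup_comm (commute_resolventOp_yosida hA (hne n) one_ne_zero) t) y).symm
  -- Limit of the comparison of exp(-itB_n) with the group of the zero operator.
  have hVlip : ∀ x ∈ A.domain, ∀ t, ‖V t x - x‖ ≤ |t| * ‖act A x‖ := fun x hx t => by
    refine le_of_tendsto_of_tendsto ((hV t x).sub_const x).norm
      (tendsto_const_nhds.mul (hBt x hx).norm) (Eventually.of_forall fun n => ?_)
    have h := expGroup_sub_apply_norm_le (hB n) (IsSelfAdjoint.zero _) (Commute.zero_right _) t x
    simpa [expGroup] using h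
  have hVsub : ∀ s t x, ‖V s x - V t x‖ = ‖V (s - t) x - x‖ := fun s t x => by
    rw [← hVnorm t (V (s - t) x - x), map_sub, ← hVadd, add_sub_cancel]
  have hVzero : ∀ x, Tendsto (fun t => V t x) (𝓝 0) (𝓝 x) := by
    refine tendsto_of_dense_of_norm_le (f := ContinuousLinearMap.id ℂ H)
      (fun t x => (hVnorm t x).le) hA.dense_domain fun x hx => ?_
    rw [tendsto_iff_norm_sub_tendsto_zero]
    refine squeeze_zero (fun _ => norm_nonneg _) (fun t => hVlip x hx t) ?_
    have : Continuous fun t : ℝ => |t| * ‖act A x‖ := by fun_prop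
    simpa using this.tendsto 0
  have hVcont : ∀ x, Continuous fun t => V t x := fun x =>
    continuous_iff_continuousAt.2 fun t => by
      rw [ContinuousAt, tendsto_iff_norm_sub_tendsto_zero]
      simp only [hVsub]
      rw [← tendsto_iff_norm_sub_tendsto_zero (b := x)]
      refine (hVzero x).comp ?_
      have : Continuous fun s : ℝ => s - t := by fun_prop
      simpa using this.tendsto t
  -- Derivatives need not pass to the limit, but the integrated equation does, by dominated
  -- convergence; differentiating it afterwards identifies the generator.
  have hint : ∀ x ∈ A.domain, ∀ t, V t x = x + ∫ s in (0 : ℝ)..t, V s (-Complex.I • act A x) := by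
    intro x hx t
    have h1 : ∀ n, ∫ s in (0 : ℝ)..t, expGroup (B n) s (-Complex.I • B n x)
        = expGroup (B n) t x - x := fun n => by
      rw [intervalIntegral.integral_eq_sub_of_hasDerivAt
        (fun s _ => hasDerivAt_expGroup s x) ((continuous_expGroup _).intervalIntegrable _ _),
        expGroup_zero]
      rfl
    have h2 : Tendsto (fun n => ∫ s in (0 : ℝ)..t, expGroup (B n) s (-Complex.I • B n x)) atTop
        (𝓝 (∫ s in (0 : ℝ)..t, V s (-Complex.I • act A x))) := by
      refine intervalIntegral.tendsto_integral_filter_of_dominated_convergence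
        (fun _ => ‖act A x‖)
        (Eventually.of_forall fun n => (continuous_expGroup _).aestronglyMeasurable)
        (Eventually.of_forall fun n => Eventually.of_forall fun s _ => ?_)
        intervalIntegrable_const
        (Eventually.of_forall fun s _ => hcomp s _ _ ((hBt x hx).const_smul _))
      rw [hnorm, norm_smul]
      rw [norm_neg, Complex.norm_I, one_mul]
      exact norm_yosida_apply_le hA (hne n) hx
    simp only [h1] at h2
    rw [← tendsto_nhds_unique ((hV t x).sub_const x) h2]
    abel
  refine ⟨V, hV0, hVadd, hVnorm, hVcont, hVcomm, fun x hx t => ?_⟩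
  rw [show (fun s => V s x) = fun s => x + ∫ s in (0 : ℝ)..s, V s (-Complex.I • act A x) from
    funext fun s => hint x hx s]
  exact (intervalIntegral.integral_hasDerivAt_right ((hVcont _).intervalIntegrable _ _)
    ((hVcont _).stronglyMeasurableAtFilter _ _) (hVcont _).continuousAt).const_add x

end Group

namespace IsEvolutionGroup

variable {A : H →ₗ.[ℂ] H} {V : ℝ → H →L[ℂ] H}

theorem apply_neg_apply (hV : IsEvolutionGroup A V) (t : ℝ) (x : H) : V t (V (-t) x) = x := by
  rw [← hV.map_add, add_neg_cancel, hV.map_zero]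

theorem continuous_uncurry (hV : IsEvolutionGroup A V) :
    Continuous fun p : ℝ × H => V p.1 p.2 :=
  continuous_prod_of_continuous_lipschitzWith' _ 1
    (fun t => LipschitzWith.of_dist_le_mul fun x y => by
      simp only [dist_eq_norm, ← map_sub, hV.norm_map, NNReal.coe_one, one_mul, le_refl])
    hV.continuous

/-- A product rule although V is only strongly continuous. Write u(τ) = u(t) + (u(τ) - u(t)): the
first term needs only u(t) ∈ D(A), and the difference quotient of the second converges by joint
continuity of (s, x) ↦ V(s)x. -/
theorem hasDerivWithinAt_apply (hV : IsEvolutionGroup A V) (c : ℝ) {u : ℝ → H} {u' : H}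
    {s : Set ℝ} {t : ℝ} (hu : HasDerivWithinAt u u' s t) (ht : u t ∈ A.domain) :
    HasDerivWithinAt (fun τ => V (c * τ) (u τ))
      (V (c * t) (u' + (c : ℂ) • (-Complex.I • act A (u t)))) s t := by
  have h1 : HasDerivWithinAt (fun τ => V (c * τ) (u t))
      (c • V (c * t) (-Complex.I • act A (u t))) s t := by
    have h := (hV.hasDerivAt _ ht (c * t)).scomp t ((hasDerivAt_id t).const_mul c)
    rw [mul_one] at h
    exact h.hasDerivWithinAt
  have h2 : HasDerivWithinAt (fun τ => V (c * τ) (u τ - u t)) (V (c * t) u') s t := by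
    rw [hasDerivWithinAt_iff_tendsto_slope] at hu ⊢
    have hc : Tendsto (fun τ : ℝ => c * τ) (𝓝[s \ {t}] t) (𝓝 (c * t)) :=
      ((continuous_const_mul c).tendsto t).mono_left nhdsWithin_le_nhds
    refine ((hV.continuous_uncurry.tendsto (c * t, u')).comp (hc.prodMk_nhds hu)).congr
      fun τ => ?_
    rw [Function.comp_apply, slope_def_module, slope_def_module, sub_self, _root_.map_zero, sub_zero]
    exact (V (c * τ)).toLinearMap.map_smul_of_tower _ _
  refine ((h1.add h2).congr_deriv ?_).congr (fun τ _ => ?_) ?_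
  · rw [_root_.map_add, (V (c * t)).map_smul (c : ℂ), add_comm]
    rfl
  · simp
  · simp

end IsEvolutionGroup

/-! ### D(A^N) as a Banach space of tuples -/

section GraphSpace

/-- The space `D(A ^ N)` realized as the tuples `(x, A x, ..., A ^ N x)`. -/
def graphSpace (A : H →ₗ.[ℂ] H) (N : ℕ) : Submodule ℂ (Fin (N + 1) → H) where
  carrier := {v | ∀ i : Fin N, v i.castSucc ∈ A.domain ∧ act A (v i.castSucc) = v i.succ}
  add_mem' := fun {v w} hv hw i =>
    ⟨A.domain.add_mem (hv i).1 (hw i).1, by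
      simp only [Pi.add_apply, act_add (hv i).1 (hw i).1, (hv i).2, (hw i).2]⟩
  zero_mem' := fun _ => ⟨A.domain.zero_mem, act_zero⟩
  smul_mem' := fun c v hv i =>
    ⟨A.domain.smul_mem c (hv i).1, by simp only [Pi.smul_apply, act_smul c (hv i).1, (hv i).2]⟩

variable {A : H →ₗ.[ℂ] H} {N : ℕ}

theorem powAct_succ (j : ℕ) (x : H) : powAct A (j + 1) x = act A (powAct A j x) :=
  Function.iterate_succ_apply' _ _ _

theorem powAct_eq (v : graphSpace A N) (i : Fin (N + 1)) : powAct A i (v.1 0) = v.1 i := by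
  induction i using Fin.induction with
  | zero => rfl
  | succ i ih =>
    rw [Fin.val_succ, powAct_succ, ← (v.2 i).2, ← ih]
    rfl

theorem mem_powDom (v : graphSpace A N) : v.1 0 ∈ powDom A N := fun i hi => by
  have h := (v.2 ⟨i, hi⟩).1
  rwa [← powAct_eq] at h

theorem powAct_mem_graphSpace {x : H} (hx : x ∈ powDom A N) :
    (fun i : Fin (N + 1) => powAct A i x) ∈ graphSpace A N := fun i =>
  ⟨hx i i.2, (powAct_succ _ _).symm⟩

theorem isClosed_graphSpace (hA : A.IsClosed) :
    IsClosed (graphSpace A N : Set (Fin (N + 1) → H)) := by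
  have h : (graphSpace A N : Set (Fin (N + 1) → H)) =
      ⋂ i : Fin N, (fun v => (v i.castSucc, v i.succ)) ⁻¹' (A.graph : Set (H × H)) := by
    ext v
    rw [mem_iInter]
    exact forall_congr' fun i =>
      (mem_graph_iff_act (p := (v i.castSucc, v i.succ))).symm
  rw [h]
  exact isClosed_iInter fun i => hA.preimage (by fun_prop)

/-- The action on `D(A ^ N)` of a bounded operator commuting with `A`. -/
def mapGraph (B : H →L[ℂ] H) (hB : CommutesWith A B) (v : graphSpace A N) : graphSpace A N :=
  ⟨fun i => B (v.1 i), fun i =>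
    ⟨(hB _ (v.2 i).1).1, by rw [(hB _ (v.2 i).1).2, (v.2 i).2]⟩⟩

theorem norm_coord_le (v : graphSpace A N) (i : Fin (N + 1)) : ‖v.1 i‖ ≤ ‖v‖ := norm_le_pi_norm v.1 i

theorem norm_le_of_coord {v : graphSpace A N} {r : ℝ} (hr : 0 ≤ r) (h : ∀ i, ‖v.1 i‖ ≤ r) :
    ‖v‖ ≤ r := (pi_norm_le_iff_of_nonneg hr).2 h

theorem norm_mapGraph {B : H →L[ℂ] H} {hB : CommutesWith A B} (h : ∀ x, ‖B x‖ = ‖x‖)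
    (v : graphSpace A N) : ‖mapGraph B hB v‖ = ‖v‖ :=
  le_antisymm
    (norm_le_of_coord (norm_nonneg _) fun i => (h _).le.trans (norm_coord_le v i))
    (norm_le_of_coord (norm_nonneg _) fun i => (h _).ge.trans (norm_coord_le (mapGraph B hB v) i))

theorem mapGraph_sub {B : H →L[ℂ] H} {hB : CommutesWith A B} (v w : graphSpace A N) :
    mapGraph B hB v - mapGraph B hB w = mapGraph B hB (v - w) :=
  Subtype.ext (funext fun _ => (map_sub B _ _).symm)

/-- The map induced on `D(A ^ N)` by a map of `H` preserving `D(A ^ N)`. -/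
noncomputable def liftGraph (J : H → H) (hJ : MapsTo J (powDom A N) (powDom A N)) (v : graphSpace A N) :
    graphSpace A N :=
  ⟨fun i => powAct A i (J (v.1 0)), powAct_mem_graphSpace (hJ (mem_powDom v))⟩

end GraphSpace

/-! ### Uniform bounds for the nonlinearity on balls -/

section Bounds

variable {A : H →ₗ.[ℂ] H} {N : ℕ} {J : H → H}

/-- Monotonicity replaces each constant by its value at (M, ..., M). The estimates stay entrywise so
that Gronwall can later be run for each power of A separately. -/
theorem Nonlinearity.exists_bound (hJ : Nonlinearity A N J) (M : ℝ) :
    ∃ K : ℝ, 0 ≤ K ∧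
      (∀ v : graphSpace A N, ‖v‖ ≤ M → ∀ i,
        ‖(liftGraph J (hJ.mapsTo N le_rfl) v).1 i‖ ≤ K * ‖v.1 i‖) ∧
      (∀ v w : graphSpace A N, ‖v‖ ≤ M → ‖w‖ ≤ M → ∀ i,
        ‖(liftGraph J (hJ.mapsTo N le_rfl) v - liftGraph J (hJ.mapsTo N le_rfl) w).1 i‖
          ≤ K * ‖(v - w).1 i‖) := by
  have hn : ∀ (v : graphSpace A N), ‖v‖ ≤ M → ∀ i : Fin (N + 1),
      norms A i (v.1 0) ≤ fun _ => M := fun v hv i k =>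
    (congrArg norm (powAct_eq v ⟨k, k.2.trans_le (Nat.succ_le_succ i.is_le)⟩)).le.trans
      ((norm_coord_le v _).trans hv)
  choose C hC1 hC2 using fun i : Fin (N + 1) => hJ.growth i i.is_le
  choose D hD1 hD2 using fun i : Fin (N + 1) => hJ.lipschitz i i.is_le
  have hle : ∀ (f : Fin (N + 1) → ℝ) i, f i ≤ ∑ j, |f j| := fun f i =>
    (le_abs_self _).trans
      (Finset.single_le_sum (f := fun j => |f j|) (fun _ _ => abs_nonneg _) (Finset.mem_univ i))
  have hnn : ∀ f : Fin (N + 1) → ℝ, 0 ≤ ∑ j, |f j| := fun f =>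
    Finset.sum_nonneg fun _ _ => abs_nonneg _
  -- Absolute values are taken because the constants are not assumed nonnegative.
  set S := ∑ j, |C j fun _ => M|
  set S' := ∑ j, |D j (fun _ => M, fun _ => M)|
  refine ⟨S + S', add_nonneg (hnn _) (hnn _), fun v hv i => ?_, fun v w hv hw i => ?_⟩
  · refine (hC2 i _ (mem_powDom v)).trans ?_
    rw [powAct_eq]
    refine mul_le_mul_of_nonneg_right ?_ (norm_nonneg _)
    exact ((hC1 i (hn v hv i)).trans (hle (fun j => C j fun _ => M) i)).trans
      (le_add_of_nonneg_right (hnn _))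
  · have h := hD2 i _ (mem_powDom v) _ (mem_powDom w)
    have e1 := powAct_eq (v - w) i
    have e2 := powAct_eq
      (liftGraph J (hJ.mapsTo N le_rfl) v - liftGraph J (hJ.mapsTo N le_rfl) w) i
    rw [← e1, ← e2]
    refine h.trans (mul_le_mul_of_nonneg_right ?_ (norm_nonneg _))
    exact ((hD1 i (Prod.mk_le_mk.2 ⟨hn v hv i, hn w hw i⟩)).trans
      (hle (fun j => D j (fun _ => M, fun _ => M)) i)).trans (le_add_of_nonneg_left (hnn _))

end Bounds

/-! ### Uniqueness of strong solutions -/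

section Uniqueness

variable {A : H →ₗ.[ℂ] H} {N : ℕ} {J : H → H}

theorem mem_domain_of_mem_powDom (hN : 0 < N) {x : H} (hx : x ∈ powDom A N) : x ∈ A.domain :=
  hx 0 hN

theorem IsStrongSolution.continuousOn {θ : ℂ} {φ₀ : H} {T : ℝ} {φ : ℝ → H}
    (h : IsStrongSolution A N J θ φ₀ T φ) : ContinuousOn φ (Ico 0 T) :=
  fun t ht => (h.deriv t ht).continuousWithinAt

theorem IsStrongSolution.eqOn {V : ℝ → H →L[ℂ] H} (hV : IsEvolutionGroup A V) (hN : 0 < N)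
    (hJ : Nonlinearity A N J) {θ : ℂ} {φ₀ : H} {T : ℝ} {φ ψ : ℝ → H}
    (hφ : IsStrongSolution A N J θ φ₀ T φ) (hψ : IsStrongSolution A N J θ φ₀ T ψ) :
    EqOn φ ψ (Ico 0 T) := by
  intro b hb
  have hsub : Icc 0 b ⊆ Ico 0 T := fun t ht => ⟨ht.1, ht.2.trans_lt hb.2⟩
  obtain ⟨M₁, hM₁⟩ := isCompact_Icc.exists_bound_of_continuousOn (hφ.continuousOn.mono hsub)
  obtain ⟨M₂, hM₂⟩ := isCompact_Icc.exists_bound_of_continuousOn (hψ.continuousOn.mono hsub)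
  -- Only j = 0 can be used: an arbitrary strong solution is known to be continuous, hence locally
  -- bounded, only in the norm of H.
  obtain ⟨C, hC1, hC2⟩ := hJ.lipschitz 0 N.zero_le
  set K := C (fun _ => M₁, fun _ => M₂)
  have hlip : ∀ t ∈ Icc 0 b, ‖J (φ t) - J (ψ t)‖ ≤ K * ‖φ t - ψ t‖ := by
    intro t ht
    refine (hC2 _ (hφ.mem t (hsub ht)) _ (hψ.mem t (hsub ht))).trans
      (mul_le_mul_of_nonneg_right (hC1 (Prod.mk_le_mk.2 ⟨fun k => ?_, fun k => ?_⟩)) (norm_nonneg _))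
    · obtain rfl : k = 0 := Fin.fin_one_eq_zero k
      exact hM₁ t ht
    · obtain rfl : k = 0 := Fin.fin_one_eq_zero k
      exact hM₂ t ht
  have hdφ := fun t ht => mem_domain_of_mem_powDom hN (hφ.mem t ht)
  have hdψ := fun t ht => mem_domain_of_mem_powDom hN (hψ.mem t ht)
  let f : ℝ → H := fun t => V (-1 * t) (φ t - ψ t)
  have hderiv : ∀ t ∈ Ico 0 T, HasDerivWithinAt f
      (V (-1 * t) (J (φ t) - J (ψ t) + θ • (φ t - ψ t))) (Ico 0 T) t := by
    intro t ht
    refine (hV.hasDerivWithinAt_apply (-1) ((hφ.deriv t ht).sub (hψ.deriv t ht))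
      (A.domain.sub_mem (hdφ t ht) (hdψ t ht))).congr_deriv ?_
    congr 1
    rw [Pi.sub_apply, act_sub (hdφ t ht) (hdψ t ht)]
    push_cast
    module
  have h0 := eq_zero_of_abs_deriv_le_mul_abs_self_of_eq_zero_right (K := K + ‖θ‖)
    (fun t ht => ((hderiv t (hsub ht)).continuousWithinAt.mono hsub))
    (fun t ht => (hderiv t (hsub (Ico_subset_Icc_self ht))).mono_of_mem_nhdsWithin
      (Ico_mem_nhdsGE_of_mem (hsub (Ico_subset_Icc_self ht))))
    (by simp [f, hφ.initial, hψ.initial])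
    (fun t ht => by
      simp only [f, hV.norm_map]
      refine (norm_add_le _ _).trans ?_
      rw [norm_smul, add_mul]
      exact add_le_add_left (hlip t (Ico_subset_Icc_self ht)) _)
    b (right_mem_Icc.2 hb.1)
  rw [← sub_eq_zero, ← norm_eq_zero, ← hV.norm_map (-1 * b), norm_eq_zero]
  exact h0

end Uniqueness

/-! ### Picard–Lindelöf with control of the range -/

section Picard

/-- Retains that the Picard fixed point stays in the ball, where alone the bounds on J are available
for Gronwall. -/
theorem exists_solution_mem_closedBall {E : Type*} [NormedAddCommGroup E] [NormedSpace ℝ E]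
    [CompleteSpace E] {f : ℝ → E → E} {tmin tmax : ℝ} {t₀ : Icc tmin tmax} {x₀ x : E}
    {a r L K : ℝ≥0} (hf : IsPicardLindelof f t₀ x₀ a r L K) (hx : x ∈ Metric.closedBall x₀ r) :
    ∃ α : ℝ → E, α t₀ = x ∧ (∀ t, α t ∈ Metric.closedBall x₀ a) ∧
      ∀ t ∈ Icc tmin tmax, HasDerivWithinAt α (f t (α t)) (Icc tmin tmax) t := by
  obtain ⟨α, hα⟩ := ODE.FunSpace.exists_isFixedPt_next hf hx
  have hmem : ∀ t, α.compProj t ∈ Metric.closedBall x₀ a := fun t =>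
    α.compProj_mem_closedBall hf.mul_max_le
  refine ⟨α.compProj, by rw [ODE.FunSpace.compProj_val, ← hα, ODE.FunSpace.next_apply₀], hmem,
    fun t ht => ?_⟩
  refine (ODE.hasDerivWithinAt_picard_Icc t₀.2 hf.continuousOn_uncurry
    α.continuous_compProj.continuousOn (fun t _ => hmem t) x ht).congr_of_mem (fun t' ht' => ?_) ht
  nth_rw 1 [← hα]
  rw [ODE.FunSpace.compProj_of_mem ht', ODE.FunSpace.next_apply]

end Picard

/-! ### Existence and growth in the interaction picture -/

section Existence

variable {A : H →ₗ.[ℂ] H} {N : ℕ} {J : H → H} {V : ℝ → H →L[ℂ] H}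

/-- The right-hand side `J φ + θ φ` as a vector field on `D(A ^ N)`. -/
noncomputable def sourceField (hJ : Nonlinearity A N J) (θ : ℂ) (v : graphSpace A N) :
    graphSpace A N :=
  liftGraph J (hJ.mapsTo N le_rfl) v + θ • v

/-- The vector field of the equation in the interaction picture. -/
noncomputable def interactionField (hV : IsEvolutionGroup A V) (hJ : Nonlinearity A N J) (θ : ℂ)
    (t : ℝ) (v : graphSpace A N) : graphSpace A N :=
  mapGraph (V (-t)) (hV.commutesWith _)
    (sourceField hJ θ (mapGraph (V t) (hV.commutesWith _) v))

theorem IsEvolutionGroup.norm_mapGraph (hV : IsEvolutionGroup A V) (t : ℝ) (v : graphSpace A N) :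
    ‖mapGraph (V t) (hV.commutesWith _) v‖ = ‖v‖ :=
  SemilinearEvolution.norm_mapGraph (hV.norm_map t) v

theorem IsEvolutionGroup.continuous_mapGraph (hV : IsEvolutionGroup A V) {s : ℝ → ℝ}
    (hs : Continuous s) {u : ℝ → graphSpace A N} (hu : Continuous u) :
    Continuous fun t => mapGraph (V (s t)) (hV.commutesWith _) (u t) := by
  refine Continuous.subtype_mk (continuous_pi fun i => ?_) _
  exact hV.continuous_uncurry.comp
    (hs.prodMk ((continuous_apply i).comp (continuous_subtype_val.comp hu)))

theorem exists_solution (hA : A.IsClosed) [CompleteSpace H] (hV : IsEvolutionGroup A V)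
    (hN : 0 < N) (hJ : Nonlinearity A N J) {M κ : ℝ} (hM : 0 ≤ M) (hκ : 0 ≤ κ) :
    ∃ T : ℝ, 0 < T ∧ ∃ K : ℝ, 0 ≤ K ∧ ∀ θ : ℂ, ‖θ‖ ≤ κ → ∀ φ₀ ∈ powDom A N,
      (∀ j ≤ N, ‖powAct A j φ₀‖ ≤ M) →
      ∃ φ : ℝ → H, IsStrongSolution A N J θ φ₀ T φ ∧ GraphContinuousOn A N T φ ∧
        ∀ t ∈ Ico 0 T, graphNorm A N (φ t) ≤ graphNorm A N φ₀ * Real.exp (K * t) := by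
  have : CompleteSpace (graphSpace A N) := (isClosed_graphSpace hA).completeSpace_coe
  obtain ⟨K₀, hK₀, hgrow, hlip⟩ := hJ.exists_bound (M + 1)
  set K := K₀ + κ with hKdef
  have hK : 0 ≤ K := add_nonneg hK₀ hκ
  set L := K * (M + 1) with hLdef
  have hL : 0 ≤ L := by positivity
  -- L bounds the speed on the ball of radius M + 1, so a path starting in radius M stays inside for
  -- time T once LT ≤ 1. The added 1 covers L = 0.
  set T := (L + 1)⁻¹ with hTdef
  have hT : 0 < T := by positivity
  have hLT : L * T ≤ 1 := by
    rw [hTdef, ← div_eq_mul_inv, div_le_one (by positivity)]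
    linarith
  refine ⟨T, hT, K, hK, fun θ hθ φ₀ hφ₀ hS => ?_⟩
  have hsrc : ∀ v : graphSpace A N, ‖v‖ ≤ M + 1 → ∀ i,
      ‖(sourceField hJ θ v).1 i‖ ≤ K * ‖v.1 i‖ := fun v hv i => by
    refine (norm_add_le _ _).trans ?_
    rw [hKdef, add_mul]
    refine add_le_add (hgrow v hv i) ?_
    refine (norm_smul_le _ _).trans ?_
    gcongr
  have hsrclip : ∀ v w : graphSpace A N, ‖v‖ ≤ M + 1 → ‖w‖ ≤ M + 1 →
      ‖sourceField hJ θ v - sourceField hJ θ w‖ ≤ K * ‖v - w‖ := fun v w hv hw => by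
    have e : sourceField hJ θ v - sourceField hJ θ w =
        (liftGraph J (hJ.mapsTo N le_rfl) v - liftGraph J (hJ.mapsTo N le_rfl) w) +
          θ • (v - w) := by
      unfold sourceField; module
    rw [e, hKdef, add_mul]
    refine (norm_add_le _ _).trans (add_le_add ?_ ?_)
    · exact norm_le_of_coord (by positivity) fun i => (hlip v w hv hw i).trans
        (mul_le_mul_of_nonneg_left (norm_coord_le _ i) hK₀)
    · rw [norm_smul]
      gcongr
  have hfield : ∀ t (v : graphSpace A N), ‖v‖ ≤ M + 1 → ∀ i,
      ‖(interactionField hV hJ θ t v).1 i‖ ≤ K * ‖v.1 i‖ := fun t v hv i => by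
    refine (hV.norm_map _ _).le.trans ((hsrc _ ((hV.norm_mapGraph t v).le.trans hv) i).trans ?_)
    exact (congrArg (K * ·) (hV.norm_map t (v.1 i))).le
  -- The ball is centred at 0, not at φ₀, so that T does not depend on the initial value.
  have hPL : IsPicardLindelof (interactionField hV hJ θ) (tmin := 0) (tmax := T)
      ⟨0, left_mem_Icc.2 hT.le⟩ (0 : graphSpace A N) (Real.toNNReal (M + 1)) (Real.toNNReal M)
      (Real.toNNReal L) (Real.toNNReal K) := by
    have hM1 : ((Real.toNNReal (M + 1) : ℝ≥0) : ℝ) = M + 1 := Real.coe_toNNReal _ (by positivity)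
    refine ⟨fun t _ => ?_, fun v hv => ?_, fun t _ v hv => ?_, ?_⟩
    · refine LipschitzOnWith.of_dist_le_mul fun v hv w hw => ?_
      rw [mem_closedBall_zero_iff, hM1] at hv hw
      rw [dist_eq_norm, dist_eq_norm, Real.coe_toNNReal _ hK]
      unfold interactionField
      rw [mapGraph_sub, hV.norm_mapGraph]
      refine (hsrclip _ _ ((hV.norm_mapGraph t v).le.trans hv)
        ((hV.norm_mapGraph t w).le.trans hw)).trans ?_
      rw [mapGraph_sub, hV.norm_mapGraph]
    · rw [mem_closedBall_zero_iff, hM1] at hv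
      refine (hV.continuous_mapGraph continuous_neg ?_).continuousOn
      have hcont : ContinuousOn (sourceField hJ θ) (Metric.closedBall 0 (M + 1)) := by
        refine (LipschitzOnWith.of_dist_le_mul (K := Real.toNNReal K)
          fun v hv w hw => ?_).continuousOn
        rw [mem_closedBall_zero_iff] at hv hw
        rw [dist_eq_norm, dist_eq_norm, Real.coe_toNNReal _ hK]
        exact hsrclip v w hv hw
      refine hcont.comp_continuous (hV.continuous_mapGraph continuous_id continuous_const)
        fun t => ?_
      rw [mem_closedBall_zero_iff]
      exact (hV.norm_mapGraph t v).le.trans hv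
    · rw [mem_closedBall_zero_iff, hM1] at hv
      rw [Real.coe_toNNReal _ hL]
      exact norm_le_of_coord hL fun i => (hfield t v hv i).trans
        (mul_le_mul_of_nonneg_left ((norm_coord_le v i).trans hv) hK)
    · rw [hM1, Real.coe_toNNReal _ hL, Real.coe_toNNReal _ hM]
      simp only [sub_zero, sub_self]
      rw [max_eq_left hT.le]
      linarith
  obtain ⟨w, hw0, hwball, hw⟩ := exists_solution_mem_closedBall hPL
    (x := ⟨_, powAct_mem_graphSpace hφ₀⟩) (by
      rw [mem_closedBall_zero_iff, Real.coe_toNNReal _ hM]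
      exact norm_le_of_coord hM fun i => hS i i.is_le)
  have hwball' : ∀ t, ‖w t‖ ≤ M + 1 := fun t => by
    have h := hwball t
    rwa [mem_closedBall_zero_iff, Real.coe_toNNReal _ (by positivity)] at h
  have hwi : ∀ i, ∀ t ∈ Icc 0 T, HasDerivWithinAt (fun τ => (w τ).1 i)
      ((interactionField hV hJ θ t (w t)).1 i) (Icc 0 T) t := fun i t ht =>
    (((ContinuousLinearMap.proj (R := ℂ) (φ := fun _ : Fin (N + 1) => H) i).comp
      (graphSpace A N).subtypeL).restrictScalars ℝ).hasFDerivAt.comp_hasDerivWithinAt t (hw t ht)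
  let u : ℝ → graphSpace A N := fun t => mapGraph (V t) (hV.commutesWith _) (w t)
  have hupow : ∀ t (i : Fin (N + 1)), powAct A i ((u t).1 0) = V t ((w t).1 i) := fun t i =>
    powAct_eq (u t) i
  refine ⟨fun t => (u t).1 0, ⟨fun t _ => mem_powDom _, ?_, fun t ht => ?_⟩, fun j hj t ht => ?_,
    fun t ht => ?_⟩
  · change V 0 ((w 0).1 0) = φ₀
    rw [hV.map_zero, hw0]
    rfl
  · have hdom : (w t).1 0 ∈ A.domain := mem_domain_of_mem_powDom hN (mem_powDom (w t))
    have h := hV.hasDerivWithinAt_apply 1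
      ((hwi 0 t (Ico_subset_Icc_self ht)).mono Ico_subset_Icc_self) hdom
    simp only [one_mul, Complex.ofReal_one, one_smul] at h
    refine h.congr_deriv ?_
    have e1 : V t ((interactionField hV hJ θ t (w t)).1 0) = J ((u t).1 0) + θ • (u t).1 0 :=
      hV.apply_neg_apply t _
    have e2 : act A ((u t).1 0) = V t (act A ((w t).1 0)) := (hV.commutesWith t _ hdom).2
    rw [_root_.map_add, e1, e2, map_smul]
    module
  · have hc : ContinuousWithinAt (fun t => V t ((w t).1 ⟨j, Nat.lt_succ_of_le hj⟩)) (Ico 0 T) t :=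
      hV.continuous_uncurry.continuousAt.comp_continuousWithinAt
        (continuousWithinAt_id.prodMk
          ((hwi _ t (Ico_subset_Icc_self ht)).continuousWithinAt.mono Ico_subset_Icc_self))
    exact hc.congr (fun s _ => hupow s ⟨j, Nat.lt_succ_of_le hj⟩)
      (hupow t ⟨j, Nat.lt_succ_of_le hj⟩)
  · unfold graphNorm
    rw [Finset.sum_mul]
    refine Finset.sum_le_sum fun j hj => ?_
    let i : Fin (N + 1) := ⟨j, Finset.mem_range.1 hj⟩
    have e : ‖powAct A j ((u t).1 0)‖ = ‖(w t).1 i‖ :=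
      (congrArg norm (hupow t i)).trans (hV.norm_map _ _)
    rw [e]
    -- Applied to one entry at a time; summing then gives the graph norm without a factor from
    -- comparing it with the sup norm.
    have hg := norm_le_gronwallBound_of_norm_deriv_right_le (ε := 0) (K := K)
      (δ := ‖powAct A j φ₀‖) (fun s hs => (hwi i s hs).continuousWithinAt)
      (fun s hs => (hwi i s (Ico_subset_Icc_self hs)).mono_of_mem_nhdsWithin
        (Icc_mem_nhdsGE_of_mem hs))
      (by simp only [hw0]; exact le_rfl)
      (fun s _ => by rw [add_zero]; exact hfield s _ (hwball' s) i)
      t (Ico_subset_Icc_self ht)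
    rwa [gronwallBound_ε0, sub_zero] at hg

end Existence

end SemilinearEvolution

/-! ### The main theorem -/

open SemilinearEvolution in
theorem theorem2p5 {H : Type*} [NormedAddCommGroup H] [InnerProductSpace ℂ H] [CompleteSpace H]
    (A : H →ₗ.[ℂ] H) (hA : IsSelfAdjoint A)
    (N : ℕ) (hN : 0 < N)
    (J : H → H) (hJ : Nonlinearity A N J)
    {E : Type*} [AddCommGroup E] [Module ℂ E]
    (Θ : E → ℂ) (ζ η : E) (hΘ : Differentiable ℂ (fun z : ℂ => Θ (ζ + z • η)))
    (a : ℕ → ℝ) (R : ℝ) :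
    ∃ T : ℝ, 0 < T ∧
      -- existence and uniqueness, with one `T` for all data in the set
      (∀ z : ℂ, ‖z‖ ≤ R → ∀ φ₀ ∈ powDom A N, (∀ j ≤ N, ‖powAct A j φ₀‖ ≤ a j) →
        ∃ φ : ℝ → H, IsStrongSolution A N J (Θ (ζ + z • η)) φ₀ T φ ∧
          GraphContinuousOn A N T φ ∧
          ∀ ψ : ℝ → H, IsStrongSolution A N J (Θ (ζ + z • η)) φ₀ T ψ →
            EqOn ψ φ (Ico 0 T)) ∧
      -- the estimate with factor `exp (t * C * ‖z‖)`, uniformly for `z` away from `0`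
      (∀ r : ℝ, 0 < r → ∃ C : ℝ, 0 ≤ C ∧ ∀ z : ℂ, r ≤ ‖z‖ → ‖z‖ ≤ R →
        ∀ φ₀ ∈ powDom A N, (∀ j ≤ N, ‖powAct A j φ₀‖ ≤ a j) →
        ∀ φ : ℝ → H, IsStrongSolution A N J (Θ (ζ + z • η)) φ₀ T φ →
          ∀ t ∈ Ico 0 T, graphNorm A N (φ t) ≤ graphNorm A N φ₀ * Real.exp (t * C * ‖z‖)) ∧
      -- the estimate in a form that includes `z = 0`
      (∃ C : ℝ, 0 ≤ C ∧ ∀ z : ℂ, ‖z‖ ≤ R →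
        ∀ φ₀ ∈ powDom A N, (∀ j ≤ N, ‖powAct A j φ₀‖ ≤ a j) →
        ∀ φ : ℝ → H, IsStrongSolution A N J (Θ (ζ + z • η)) φ₀ T φ →
          ∀ t ∈ Ico 0 T,
            graphNorm A N (φ t) ≤ graphNorm A N φ₀ * Real.exp (t * C * (1 + ‖z‖))) := by
  obtain ⟨V, hV⟩ := exists_isEvolutionGroup hA
  -- Holomorphy enters through boundedness on the compact disc. For R < 0 the disc is empty and κ
  -- may be negative, hence |κ| below.
  obtain ⟨κ, hκ⟩ := (isCompact_closedBall (0 : ℂ) R).exists_bound_of_continuousOn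
    hΘ.continuous.continuousOn
  have hM : 0 ≤ ∑ j ∈ Finset.range (N + 1), |a j| := Finset.sum_nonneg fun _ _ => abs_nonneg _
  have haM : ∀ j ≤ N, a j ≤ ∑ j ∈ Finset.range (N + 1), |a j| := fun j hj =>
    (le_abs_self _).trans (Finset.single_le_sum (f := fun j => |a j|) (fun _ _ => abs_nonneg _)
      (Finset.mem_range.2 (Nat.lt_succ_of_le hj)))
  obtain ⟨T, hT, K, hK, hex⟩ := exists_solution hA.isClosed hV hN hJ hM (abs_nonneg κ)
  have key : ∀ z : ℂ, ‖z‖ ≤ R → ∀ φ₀ ∈ powDom A N, (∀ j ≤ N, ‖powAct A j φ₀‖ ≤ a j) →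
      ∃ φ : ℝ → H, IsStrongSolution A N J (Θ (ζ + z • η)) φ₀ T φ ∧ GraphContinuousOn A N T φ ∧
        ∀ t ∈ Ico 0 T, graphNorm A N (φ t) ≤ graphNorm A N φ₀ * Real.exp (K * t) :=
    fun z hz φ₀ hφ₀ hS => hex _
      ((hκ z (mem_closedBall_zero_iff.2 hz)).trans (le_abs_self κ)) φ₀ hφ₀
      fun j hj => (hS j hj).trans (haM j hj)
  -- By uniqueness, the estimate for the constructed solution holds for every strong solution; c
  -- will be |z| or 1 + |z|.
  have bound : ∀ C c : ℝ, ∀ z : ℂ, K ≤ C * c → ‖z‖ ≤ R → ∀ φ₀ ∈ powDom A N,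
      (∀ j ≤ N, ‖powAct A j φ₀‖ ≤ a j) →
      ∀ φ : ℝ → H, IsStrongSolution A N J (Θ (ζ + z • η)) φ₀ T φ → ∀ t ∈ Ico 0 T,
        graphNorm A N (φ t) ≤ graphNorm A N φ₀ * Real.exp (t * C * c) := by
    intro C c z hC hz φ₀ hφ₀ hS φ hφ t ht
    obtain ⟨ψ, hψ, -, hψb⟩ := key z hz φ₀ hφ₀ hS
    rw [hφ.eqOn hV hN hJ hψ ht]
    refine (hψb t ht).trans (mul_le_mul_of_nonneg_left (Real.exp_le_exp.2 ?_)
      (Finset.sum_nonneg fun _ _ => norm_nonneg _))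
    rw [mul_assoc, mul_comm]
    exact mul_le_mul_of_nonneg_left hC ht.1
  refine ⟨T, hT, fun z hz φ₀ hφ₀ hS => ?_, fun r hr => ⟨K / r, by positivity,
    fun z hrz hz => bound _ _ z ?_ hz⟩, ⟨K, hK, fun z hz => bound _ _ z ?_ hz⟩⟩
  · obtain ⟨φ, hφ, hφc, -⟩ := key z hz φ₀ hφ₀ hS
    exact ⟨φ, hφ, hφc, fun ψ hψ => hψ.eqOn hV hN hJ hφ⟩
  · rw [div_mul_eq_mul_div, le_div_iff₀ hr]
    exact mul_le_mul_of_nonneg_left hrz hK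
  · exact le_mul_of_one_le_right hK (le_add_of_nonneg_right (norm_nonneg z))
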